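/- Let $\mathbb K$ be $\mathbb R$ or $\mathbb C$. Let $\omega_1$ be the first uncountable ordinal. For an ordinal $\sigma$, let $[0,\sigma]$ be the set of ordinals less than or equal to $\sigma$, equipped with its (compact Hausdorff) order topology, and let $C([0,\sigma])$ be the Banach space of continuous $\mathbb K$-valued functions on $[0,\sigma]$ with the supremum norm. By an operator we mean a bounded linear map between Banach spaces; $\mathscr B(X,Y)$ denotes the Banach space of operators from $X$ to $Y$ with the operator norm. For a countable ordinal $\sigma$, let $\widetilde P_\sigma$ be the operator on $C([0,\omega_1])$ given by \[ \widetilde P_\sigma f = f\cdot\mathbf 1_{[0,\sigma]} + f(\omega_1)\,\mathbf 1_{[\sigma+1,\omega_1]}\qquad (f\in C([0,\omega_1])), \] and let \[ \mathscr G_{C([0,\sigma])}(C([0,\omega_1])) = \operatorname{lin}\{RS : S\in\mathscr B(C([0,\omega_1]),C([0,\sigma])),\ R\in\mathscr B(C([0,\sigma]),C([0,\omega_1]))\}, \] with closure $\overline{\mathscr G}_{C([0,\sigma])}(C([0,\omega_1]))$ in the operator norm. Let $c_0(\omega_1)$ be the Banach space of functions $f\colon[0,\omega_1)\to\mathbb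 K$ such that $\{\alpha\in[0,\omega_1) : |f(\alpha)|\ge\varepsilon\}$ is finite for each $\varepsilon>0$, with the supremum norm. An operator $T$ on a Banach space $X$ fixes a copy of a Banach space $Z$ if there are a subspace $W$ of $X$ linearly homeomorphic to $Z$ and a constant $c>0$ such that $\|Tx\|\ge c\|x\|$ for all $x\in W$. **Theorem 1.3.** The following five conditions are equivalent for an operator $T$ on $C([0,\omega_1])$: (a) $T=\widetilde P_\sigma T\widetilde P_\sigma$ for some countable ordinal $\sigma$; (b) $T\in\mathscr G_{C([0,\sigma])}(C([0,\omega_1]))$ for some countable ordinal $\sigma$; (c) $T\in\overline{\mathscr G}_{C([0,\sigma])}(C([0,\omega_1]))$ for some countable ordinal $\sigma$; (d) $T$ has separable range; (e) $T$ does not fix a copy of $c_0(\omega_1)$. -/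

import Mathlib

open scoped Ordinal ENNReal

noncomputable section

namespace OrdinalInterval

/-- The closed ordinal interval `[0, σ]`, as a subspace of the ordinals with the order topology. -/
abbrev Upto (σ : Ordinal.{0}) : Type 1 := Set.Iic σ

/-- The topology that `[0, σ]` carries is its own order topology. -/
theorem orderTopology_upto (σ : Ordinal.{0}) : OrderTopology (Upto σ) := inferInstance

instance compactSpace_upto (σ : Ordinal.{0}) : CompactSpace (Upto σ) := by
  have h : Set.Iic σ = Set.Icc ⊥ σ := Set.Icc_bot.symm
  exact isCompact_iff_compactSpace.mp (h ▸ isCompact_Icc)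

/-- The point `ω₁` of `[0, ω₁]`. -/
def top : Upto ω₁ := ⟨ω₁, Set.self_mem_Iic⟩

theorem isClopen_le (σ : Ordinal.{0}) : IsClopen {x : Upto ω₁ | (x : Ordinal) ≤ σ} := by
  have h : IsClopen (Set.Iic σ) := by
    refine ⟨isClosed_Iic, ?_⟩
    rw [← Order.Iio_succ]
    exact isOpen_Iio
  exact h.preimage continuous_subtype_val

theorem isClopen_succ_le (σ : Ordinal.{0}) : IsClopen {x : Upto ω₁ | σ + 1 ≤ (x : Ordinal)} := by
  have h : {x : Upto ω₁ | σ + 1 ≤ (x : Ordinal)} = {x : Upto ω₁ | (x : Ordinal) ≤ σ}ᶜ := by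
    ext x
    simp [← Order.succ_eq_add_one]
  rw [h]
  exact (isClopen_le σ).compl

variable (𝕜 : Type*) [RCLike 𝕜]

/-- The indicator function of `[0, σ]` as an element of `C([0, ω₁])`. -/
def indLE (σ : Ordinal.{0}) : C(Upto ω₁, 𝕜) :=
  (LocallyConstant.charFn 𝕜 (isClopen_le σ)).toContinuousMap

/-- The indicator function of `[σ + 1, ω₁]` as an element of `C([0, ω₁])`. -/
def indGT (σ : Ordinal.{0}) : C(Upto ω₁, 𝕜) :=
  (LocallyConstant.charFn 𝕜 (isClopen_succ_le σ)).toContinuousMap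

/-- The projection `P_σ f = f · 1_[0,σ]` on `C([0, ω₁])`. -/
def P (σ : Ordinal.{0}) : C(Upto ω₁, 𝕜) →L[𝕜] C(Upto ω₁, 𝕜) :=
  ContinuousLinearMap.mul 𝕜 C(Upto ω₁, 𝕜) (indLE 𝕜 σ)

/-- The rank-one perturbation `P̃_σ f = P_σ f + f(ω₁) · 1_[σ+1,ω₁]` of `P_σ`. -/
def Ptilde (σ : Ordinal.{0}) : C(Upto ω₁, 𝕜) →L[𝕜] C(Upto ω₁, 𝕜) :=
  P 𝕜 σ + (ContinuousMap.evalCLM 𝕜 top).smulRight (indGT 𝕜 σ)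

/-- The Banach space `c₀(I)` of scalar-valued functions `f` on `I` such that `{i | ε ≤ |f i|}`
is finite for each `ε > 0`, with the supremum norm. (Every such function is bounded.) -/
def c0 (I : Type*) : Submodule 𝕜 (lp (fun _ : I => 𝕜) ∞) where
  carrier := {f | ∀ ε : ℝ, 0 < ε → {i : I | ε ≤ ‖f i‖}.Finite}
  zero_mem' := by
    intro ε hε
    convert Set.finite_empty (α := I)
    ext i
    simpa using hε
  add_mem' := by
    intro f g hf hg ε hε
    refine ((hf (ε / 2) (half_pos hε)).union (hg (ε / 2) (half_pos hε))).subset ?_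
    intro i hi
    by_contra hcon
    simp only [Set.mem_union, Set.mem_ofPred_eq, not_or, not_le] at hcon
    have h1 : ε ≤ ‖f i + g i‖ := hi
    have h2 := norm_add_le (f i) (g i)
    linarith [hcon.1, hcon.2]
  smul_mem' := by
    intro c f hf ε hε
    have hc : 0 < ‖c‖ + 1 := by positivity
    refine (hf (ε / (‖c‖ + 1)) (by positivity)).subset ?_
    intro i hi
    have h1 : ε ≤ ‖c * f i‖ := hi
    rw [norm_mul] at h1
    rw [Set.mem_ofPred_eq, div_le_iff₀ hc]
    nlinarith [norm_nonneg (f i)]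

section Operators

variable (X Y Z : Type*) [NormedAddCommGroup X] [NormedSpace 𝕜 X]
  [NormedAddCommGroup Y] [NormedSpace 𝕜 Y] [NormedAddCommGroup Z] [NormedSpace 𝕜 Z]

/-- The linear span `𝒢_Z(X, Y)` of the operators from `X` to `Y` that factor through `Z`. -/
def factorIdeal : Submodule 𝕜 (X →L[𝕜] Y) :=
  Submodule.span 𝕜 {R | ∃ (S : X →L[𝕜] Z) (T : Z →L[𝕜] Y), R = T ∘L S}

variable {𝕜 X Y}

/-- `T` fixes a copy of `Z`: there is a subspace `W` of the domain of `T` that is linearly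
homeomorphic to `Z` and such that `T` restricted to `W` is an isomorphism onto its image,
that is, bounded below. -/
def FixesCopy (T : X →L[𝕜] Y) : Prop :=
  ∃ W : Submodule 𝕜 X, Nonempty (Z ≃L[𝕜] W) ∧ ∃ c : ℝ, 0 < c ∧ ∀ x ∈ W, c * ‖x‖ ≤ ‖T x‖

end Operators

end OrdinalInterval

end

/-! The substance is that an operator fixing no copy of `c0` over `ω₁` satisfies `T = P̃_σ T P̃_σ`
for some countable `σ`. Suppose `T` is nonzero on the kernel of every `P̃_σ`, `σ < ω₁`. Zorn's lemma
then yields uncountably many pairwise disjoint functions in the unit ball not killed by `T`. On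
uncountably many of them `‖T f‖` exceeds a fixed `δ > 0`, and Rosenthal's theorem
(`fixesCopy_c0_of_disjoint`) produces a fixed copy of `c0`. Otherwise `T = T P̃_σ` for some `σ`. As
`P̃_σ` factors through the separable space `C([0, σ + 1])`, `T` has separable range. Every
continuous function on `[0, ω₁]` is eventually constant, so one `P̃_τ` fixes a countable set whose
closure contains the range; the larger index serves on both sides. The other implications follow
from that factorization, separability of `C([0, σ])` for countable `σ`, and nonseparability of `c0`.
-/

namespace OrdinalInterval

/-! ### Rosenthal's combinatorial lemma on infinite matrices. -/

section Disjointification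

variable {I : Type*} [Infinite I]

/-- Rosenthal's disjointification lemma for nonnegative matrices with bounded row sums:
some equipotent square submatrix has small off-diagonal row sums. -/
theorem exists_embedding_sum_le_of_sum_le_nsmul {ε : ℝ} (n : ℕ) :
    ∀ a : I → I → ℝ,
      (∀ i (F : Finset I), i ∉ F → ∑ j ∈ F, a i j ≤ (n + 1) * ε) →
      ∃ e : I ↪ I, ∀ i (F : Finset I), i ∉ F → ∑ j ∈ F, a (e i) (e j) ≤ ε := by
  classical
  induction n with
  | zero =>
    intro a ha
    exact ⟨.refl I, fun i F hi => by simpa using ha i F hi⟩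
  | succ n ih =>
    intro a ha
    -- Split `I` into `I`-many blocks, each a copy of `I`. If no block works, each contains a bad
    -- row `k ξ` with mass above `ε` in its own block. The transversal of bad rows misses that mass,
    -- so its off-diagonal row sums drop by `ε` and induction applies.
    obtain ⟨p⟩ : Nonempty (I × I ≃ I) := by
      rw [← Cardinal.eq, Cardinal.mk_prod, Cardinal.lift_id]
      exact Cardinal.mul_eq_self (Cardinal.aleph0_le_mk I)
    let q (ξ : I) : I ↪ I := ⟨fun i => p (ξ, i), fun i j h => by simpa using h⟩
    by_cases hq : ∃ ξ, ∀ i (F : Finset I), i ∉ F → ∑ j ∈ F, a (q ξ i) (q ξ j) ≤ ε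
    · obtain ⟨ξ, hξ⟩ := hq
      exact ⟨q ξ, hξ⟩
    push Not at hq
    choose k G hkG hG using hq
    let e : I ↪ I := ⟨fun ξ => p (ξ, k ξ), fun i j h => by
      have := p.injective h
      simp only [Prod.mk.injEq] at this
      exact this.1⟩
    obtain ⟨e', he'⟩ := ih (fun i j => a (e i) (e j)) (by
      intro ξ F hξ
      have hdisj : Disjoint (F.map e) ((G ξ).map (q ξ)) := by
        rw [Finset.disjoint_left]
        simp only [Finset.mem_map, not_exists, not_and]
        rintro _ ⟨η, hη, rfl⟩ j hj h
        have := p.injective h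
        simp only [Prod.mk.injEq] at this
        exact hξ (this.1 ▸ hη)
      have hnot : e ξ ∉ F.map e ∪ (G ξ).map (q ξ) := by
        simp only [Finset.mem_union, Finset.mem_map, not_or, not_exists, not_and]
        refine ⟨fun η hη h => hξ (e.injective h ▸ hη), fun j hj h => ?_⟩
        have : q ξ j = q ξ (k ξ) := h
        exact hkG ξ ((q ξ).injective this ▸ hj)
      have h1 := ha (e ξ) _ hnot
      rw [Finset.sum_union hdisj, Finset.sum_map, Finset.sum_map] at h1
      have h2 : ε < ∑ j ∈ G ξ, a (e ξ) (q ξ j) := hG ξ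
      push_cast at h1
      linarith)
    exact ⟨e'.trans e, he'⟩

theorem exists_embedding_sum_le {a : I → I → ℝ} {M ε : ℝ}
    (ha : ∀ i (F : Finset I), ∑ j ∈ F, a i j ≤ M) (hε : 0 < ε) :
    ∃ e : I ↪ I, ∀ i (F : Finset I), i ∉ F → ∑ j ∈ F, a (e i) (e j) ≤ ε := by
  obtain ⟨n, hn⟩ := exists_nat_ge (M / ε)
  refine exists_embedding_sum_le_of_sum_le_nsmul n a fun i F _ => (ha i F).trans ?_
  rw [div_le_iff₀ hε] at hn
  linarith

end Disjointification

/-! ### Disjoint families in `C(K)` and copies of `c₀`. -/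

section DisjointFunctions

variable {𝕜 : Type*} [RCLike 𝕜] {K L I : Type*} [TopologicalSpace K] [CompactSpace K]
  [TopologicalSpace L] [CompactSpace L] {g : I → C(K, 𝕜)}

theorem norm_sum_smul_le_of_disjoint (hg : ∀ i, ‖g i‖ ≤ 1)
    (hd : Pairwise fun i j => g i * g j = 0) (F : Finset I) (c : I → 𝕜) {B : ℝ} (hB : 0 ≤ B)
    (hc : ∀ i ∈ F, ‖c i‖ ≤ B) : ‖∑ i ∈ F, c i • g i‖ ≤ B := by
  rw [ContinuousMap.norm_le _ hB]
  intro x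
  rw [ContinuousMap.sum_apply]
  by_cases h : ∃ i ∈ F, g i x ≠ 0
  · obtain ⟨i, hi, hx⟩ := h
    rw [Finset.sum_eq_single_of_mem i hi]
    · have h1 : ‖g i x‖ ≤ 1 := ((g i).norm_coe_le_norm x).trans (hg i)
      calc ‖(c i • g i) x‖ = ‖c i‖ * ‖g i x‖ := by
            rw [ContinuousMap.smul_apply, smul_eq_mul, norm_mul]
        _ ≤ B * 1 := mul_le_mul (hc i hi) h1 (norm_nonneg _) hB
        _ = B := mul_one B
    · intro j _ hji
      have h0 : g j x * g i x = 0 := DFunLike.congr_fun (hd hji) x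
      simp [(mul_eq_zero.mp h0).resolve_right hx]
  · push Not at h
    rw [Finset.sum_eq_zero fun i hi => by simp [h i hi]]
    simpa using hB

/-- Unimodular coefficients matching the phases of `φ (g i)` turn the sum into `φ` of a function of
norm at most one. -/
theorem sum_norm_apply_le_of_disjoint (hg : ∀ i, ‖g i‖ ≤ 1)
    (hd : Pairwise fun i j => g i * g j = 0) (φ : C(K, 𝕜) →L[𝕜] 𝕜) (F : Finset I) :
    ∑ i ∈ F, ‖φ (g i)‖ ≤ ‖φ‖ := by
  have hsign : ∀ z : 𝕜, ∃ c : 𝕜, ‖c‖ ≤ 1 ∧ c * z = (‖z‖ : 𝕜) := by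
    intro z
    obtain ⟨c, hc, h⟩ := RCLike.exists_norm_eq_mul_self z
    exact ⟨c, hc.le, h.symm⟩
  choose s hs hs' using hsign
  have h1 := φ.le_of_opNorm_le_of_le le_rfl
    (norm_sum_smul_le_of_disjoint hg hd F (fun i => s (φ (g i))) zero_le_one fun i _ => hs _)
  simp only [map_sum, map_smul, smul_eq_mul, hs', mul_one] at h1
  rwa [← RCLike.ofReal_sum, RCLike.norm_ofReal, abs_of_nonneg (by positivity)] at h1

theorem summable_c0_smul_of_disjoint (hg : ∀ i, ‖g i‖ ≤ 1)
    (hd : Pairwise fun i j => g i * g j = 0) (f : c0 𝕜 I) :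
    Summable fun i => (f : lp (fun _ : I => 𝕜) ∞) i • g i := by
  classical
  rw [summable_iff_vanishing_norm]
  intro ε hε
  refine ⟨(f.2 (ε / 2) (half_pos hε)).toFinset, fun t ht => ?_⟩
  refine (norm_sum_smul_le_of_disjoint hg hd t _ (half_pos hε).le fun i hi => ?_).trans_lt
    (half_lt_self hε)
  have := Finset.disjoint_left.mp ht hi
  simp only [Set.Finite.mem_toFinset, Set.mem_ofPred_eq, not_le] at this
  exact this.le

/-- The contraction `f ↦ ∑ i, f i • g i` from `c₀(I)` to `C(K)` for a family `g` of
pairwise disjoint functions in the unit ball. -/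
noncomputable def c0Synthesis (hg : ∀ i, ‖g i‖ ≤ 1) (hd : Pairwise fun i j => g i * g j = 0) :
    c0 𝕜 I →ₗ[𝕜] C(K, 𝕜) where
  toFun f := ∑' i, (f : lp (fun _ : I => 𝕜) ∞) i • g i
  map_add' f f' := by
    rw [← (summable_c0_smul_of_disjoint hg hd f).tsum_add (summable_c0_smul_of_disjoint hg hd f')]
    simp [add_smul]
  map_smul' c f := by
    rw [RingHom.id_apply, ← (summable_c0_smul_of_disjoint hg hd f).tsum_const_smul c]
    simp [mul_smul]

theorem norm_c0Synthesis_le (hg : ∀ i, ‖g i‖ ≤ 1) (hd : Pairwise fun i j => g i * g j = 0)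
    (f : c0 𝕜 I) : ‖c0Synthesis hg hd f‖ ≤ ‖f‖ := by
  refine le_of_tendsto (summable_c0_smul_of_disjoint hg hd f).hasSum.norm (.of_forall fun F => ?_)
  exact norm_sum_smul_le_of_disjoint hg hd F _ (norm_nonneg _) fun i _ =>
    lp.norm_apply_le_norm ENNReal.top_ne_zero _ i

/-- At `x i` the diagonal term has size at least `δ * ‖f i‖`, while the others total at most `ε *
‖f‖`; then take the supremum over `i`. -/
theorem norm_map_c0Synthesis_ge (hg : ∀ i, ‖g i‖ ≤ 1) (hd : Pairwise fun i j => g i * g j = 0)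
    (T : C(K, 𝕜) →L[𝕜] C(L, 𝕜)) {δ ε : ℝ} (x : I → L) (hx : ∀ i, δ ≤ ‖T (g i) (x i)‖)
    (hsum : ∀ i (F : Finset I), i ∉ F → ∑ j ∈ F, ‖T (g j) (x i)‖ ≤ ε) (hδ : 0 < δ)
    (f : c0 𝕜 I) : (δ - ε) * ‖f‖ ≤ ‖T (c0Synthesis hg hd f)‖ := by
  classical
  have hfi : ∀ i, ‖(f : lp (fun _ : I => 𝕜) ∞) i‖ ≤ ‖f‖ := fun i =>
    lp.norm_apply_le_norm ENNReal.top_ne_zero _ i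
  have hε : ∀ i : I, 0 ≤ ε := fun i => by simpa using hsum i ∅ (by simp)
  have key : ∀ i, δ * ‖(f : lp (fun _ : I => 𝕜) ∞) i‖ ≤
      ‖T (c0Synthesis hg hd f)‖ + ε * ‖f‖ := by
    intro i
    have hS : HasSum (fun j => (f : lp (fun _ : I => 𝕜) ∞) j * T (g j) (x i))
        (T (c0Synthesis hg hd f) (x i)) := by
      have := (summable_c0_smul_of_disjoint hg hd f).hasSum.mapL
        ((ContinuousMap.evalCLM 𝕜 (x i)) ∘L T)
      simpa [c0Synthesis] using this
    have hlim : ‖T (c0Synthesis hg hd f) (x i) - (f : lp (fun _ : I => 𝕜) ∞) i * T (g i) (x i)‖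
        ≤ ε * ‖f‖ := by
      refine le_of_tendsto (hS.sub_const _).norm ?_
      filter_upwards [Filter.eventually_ge_atTop {i}] with F hF
      have hiF : i ∈ F := hF (Finset.mem_singleton_self i)
      rw [← Finset.add_sum_erase F _ hiF, add_sub_cancel_left]
      refine (norm_sum_le _ _).trans ?_
      calc ∑ j ∈ F.erase i, ‖(f : lp (fun _ : I => 𝕜) ∞) j * T (g j) (x i)‖
          ≤ ∑ j ∈ F.erase i, ‖f‖ * ‖T (g j) (x i)‖ := by
            refine Finset.sum_le_sum fun j _ => ?_
            rw [norm_mul]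
            exact mul_le_mul_of_nonneg_right (hfi j) (norm_nonneg _)
        _ = ‖f‖ * ∑ j ∈ F.erase i, ‖T (g j) (x i)‖ := (Finset.mul_sum _ _ _).symm
        _ ≤ ‖f‖ * ε := mul_le_mul_of_nonneg_left
            (hsum i _ (Finset.notMem_erase i F)) (norm_nonneg _)
        _ = ε * ‖f‖ := mul_comm _ _
    have h1 : δ * ‖(f : lp (fun _ : I => 𝕜) ∞) i‖ ≤
        ‖(f : lp (fun _ : I => 𝕜) ∞) i * T (g i) (x i)‖ := by
      rw [norm_mul, mul_comm]
      exact mul_le_mul_of_nonneg_left (hx i) (norm_nonneg _)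
    have h2 := norm_le_norm_add_norm_sub (T (c0Synthesis hg hd f) (x i))
      ((f : lp (fun _ : I => 𝕜) ∞) i * T (g i) (x i))
    have h3 := (T (c0Synthesis hg hd f)).norm_coe_le_norm (x i)
    linarith
  rcases isEmpty_or_nonempty I with hI | ⟨⟨i₀⟩⟩
  · have : f = 0 := by ext i; exact hI.elim i
    simp [this]
  have h4 : ‖f‖ ≤ (‖T (c0Synthesis hg hd f)‖ + ε * ‖f‖) / δ := by
    refine lp.norm_le_of_forall_le (f := (f : lp (fun _ : I => 𝕜) ∞)) ?_ fun i => ?_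
    · have := hε i₀
      positivity
    · rw [le_div_iff₀ hδ, mul_comm]
      exact key i
  rw [le_div_iff₀ hδ] at h4
  linarith

theorem fixesCopy_of_linearMap {𝕜 X Y Z : Type*} [RCLike 𝕜] [NormedAddCommGroup X]
    [NormedSpace 𝕜 X] [NormedAddCommGroup Y] [NormedSpace 𝕜 Y] [NormedAddCommGroup Z]
    [NormedSpace 𝕜 Z] (T : X →L[𝕜] Y) (U : Z →ₗ[𝕜] X) (hU : ∀ z, ‖U z‖ ≤ ‖z‖) {c : ℝ}
    (hc : 0 < c) (hTU : ∀ z, c * ‖z‖ ≤ ‖T (U z)‖) : FixesCopy Z T := by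
  have hlow : ∀ z, c * ‖z‖ ≤ ‖T‖ * ‖U z‖ := fun z => (hTU z).trans (T.le_opNorm _)
  have hinj : Function.Injective U := by
    rw [injective_iff_map_eq_zero]
    intro z hz
    have := hTU z
    rw [hz, map_zero, norm_zero] at this
    rw [← norm_le_zero_iff]
    nlinarith
  let e := LinearEquiv.ofInjective U hinj
  have he : ∀ w, U (e.symm w) = w := fun w => congrArg Subtype.val (e.apply_symm_apply w)
  refine ⟨LinearMap.range U, ⟨e.toContinuousLinearEquivOfBounds 1 (‖T‖ / c) ?_ ?_⟩, c, hc, ?_⟩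
  · intro z
    rw [one_mul]
    exact hU z
  · intro w
    have := hlow (e.symm w)
    rw [he] at this
    rw [div_mul_eq_mul_div, le_div_iff₀ hc, mul_comm]
    exact this
  · rintro _ ⟨z, rfl⟩
    exact (mul_le_mul_of_nonneg_left (hU z) hc.le).trans (hTU z)

/-- **Rosenthal's theorem** for operators between spaces of continuous functions: an operator
that is bounded away from zero on an infinite family of pairwise disjoint functions in the unit
ball fixes a copy of `c₀` of the index set. -/
theorem fixesCopy_c0_of_disjoint [Infinite I] (hg : ∀ i, ‖g i‖ ≤ 1)
    (hd : Pairwise fun i j => g i * g j = 0) (T : C(K, 𝕜) →L[𝕜] C(L, 𝕜)) {δ : ℝ} (hδ : 0 < δ)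
    (hT : ∀ i, δ < ‖T (g i)‖) : FixesCopy (c0 𝕜 I) T := by
  have hx : ∀ i, ∃ x, δ ≤ ‖T (g i) x‖ := by
    intro i
    by_contra! h
    exact (hT i).not_ge ((ContinuousMap.norm_le _ hδ.le).mpr fun x => (h x).le)
  choose x hx using hx
  -- Bounded row sums let the off-diagonal mass be cut to `δ / 2`, which leaves the lower bound `δ -
  -- δ / 2`.
  have hM : ∀ i (F : Finset I), ∑ j ∈ F, ‖T (g j) (x i)‖ ≤ ‖T‖ := by
    intro i F
    refine (sum_norm_apply_le_of_disjoint hg hd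
      ((ContinuousMap.evalCLM 𝕜 (x i)) ∘L T) F).trans ?_
    refine ContinuousLinearMap.opNorm_le_bound _ (norm_nonneg _) fun h => ?_
    exact ((T h).norm_coe_le_norm (x i)).trans (T.le_opNorm h)
  obtain ⟨e, he⟩ := exists_embedding_sum_le hM (half_pos hδ)
  have hd' : Pairwise fun i j => g (e i) * g (e j) = 0 := fun i j hij =>
    hd (e.injective.ne hij)
  refine fixesCopy_of_linearMap T (c0Synthesis (fun i => hg (e i)) hd')
    (norm_c0Synthesis_le _ _) (half_pos hδ) fun f => ?_
  have := norm_map_c0Synthesis_ge (fun i => hg (e i)) hd' T (fun i => x (e i))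
    (fun i => hx (e i)) he hδ f
  rwa [sub_half] at this

end DisjointFunctions

/-! ### Eventual constancy and the projections `P̃_σ`. -/

variable {𝕜 : Type*} [RCLike 𝕜]

theorem nonempty_embedding_Iio_omega_one {α : Type*} [Uncountable α] :
    Nonempty (Set.Iio (ω₁ : Ordinal.{0}) ↪ α) := by
  rw [← Cardinal.lift_mk_le', Cardinal.mk_Iio_ordinal]
  simp [Cardinal.aleph_one_le_iff]

theorem uncountable_Iio_omega_one : Uncountable (Set.Iio (ω₁ : Ordinal.{0})) := by
  rw [← Cardinal.aleph0_lt_mk_iff, Cardinal.mk_Iio_ordinal]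
  simp

theorem countable_upto {σ : Ordinal.{0}} (hσ : σ < ω₁) : Countable (Upto σ) := by
  have h : Order.succ σ < ω₁ := (Cardinal.isSuccLimit_omega 1).succ_lt hσ
  have : Set.Iic σ = Set.Iio (Order.succ σ) := (Order.Iio_succ σ).symm
  rw [← Cardinal.mk_le_aleph0_iff, Upto, this, Cardinal.mk_Iio_ordinal, Cardinal.lift_le_aleph0,
    ← Cardinal.lt_aleph_one_iff, ← Cardinal.lt_omega_iff_card_lt]
  exact h

theorem separableSpace_continuousMap_upto {σ : Ordinal.{0}} (hσ : σ < ω₁) :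
    TopologicalSpace.SeparableSpace C(Upto σ, 𝕜) := by
  have := countable_upto hσ
  have : SecondCountableTopology (Upto σ) := by
    refine ⟨⟨Set.range Set.Ioi ∪ Set.range Set.Iio,
      (Set.countable_range _).union (Set.countable_range _), ?_⟩⟩
    refine (OrderTopology.topology_eq_generate_intervals (α := Upto σ)).trans
      (congrArg TopologicalSpace.generateFrom (Set.ext fun s => ?_))
    change (∃ a, s = Set.Ioi a ∨ s = Set.Iio a) ↔ (∃ a, Set.Ioi a = s) ∨ ∃ a, Set.Iio a = s
    rw [exists_or]
    simp only [eq_comm]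
  infer_instance

/-- For each `n`, continuity at `ω₁` gives a tail on which `f` is within `1 / (n + 1)` of its limit;
a countable supremum of countable ordinals is countable. -/
theorem exists_eq_apply_top (f : C(Upto ω₁, 𝕜)) :
    ∃ σ : Ordinal.{0}, σ < ω₁ ∧ ∀ x : Upto ω₁, σ ≤ x → f x = f top := by
  have h : ∀ n : ℕ, ∃ l : Upto ω₁, l < top ∧
      ∀ x, l < x → dist (f x) (f top) < 1 / ((n : ℝ) + 1) := by
    intro n
    have hn : {x | dist (f x) (f top) < 1 / ((n : ℝ) + 1)} ∈ nhds top :=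
      f.continuous.continuousAt (Metric.ball_mem_nhds _ Nat.one_div_pos_of_nat)
    obtain ⟨l, hl, hl'⟩ := exists_Ioc_subset_of_mem_nhds hn
      ⟨⟨0, Set.mem_Iic.mpr zero_le⟩, Subtype.mk_lt_mk.mpr (Ordinal.omega_pos 1)⟩
    exact ⟨l, hl, fun x hx => hl' ⟨hx, x.2⟩⟩
  choose l hl hl' using h
  refine ⟨⨆ n, Order.succ (l n : Ordinal.{0}), Ordinal.iSup_lt_omega_one fun n =>
    (Cardinal.isSuccLimit_omega 1).succ_lt (hl n), fun x hx => ?_⟩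
  refine dist_le_zero.mp (le_of_forall_pos_lt_add fun ε hε => ?_)
  obtain ⟨n, hn⟩ := exists_nat_one_div_lt hε
  have hlx : (l n : Ordinal) < x := Order.succ_le_iff.mp
    ((Ordinal.le_iSup (fun n => Order.succ (l n : Ordinal.{0})) n).trans hx)
  simpa using (hl' n x hlx).trans hn

theorem Ptilde_apply (σ : Ordinal.{0}) (f : C(Upto ω₁, 𝕜)) (x : Upto ω₁) :
    Ptilde 𝕜 σ f x = if (x : Ordinal) ≤ σ then f x else f top := by
  by_cases h : (x : Ordinal) ≤ σ
  · simp [Ptilde, P, indLE, indGT, h, LocallyConstant.charFn, ← Order.succ_eq_add_one]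
  · simp [Ptilde, P, indLE, indGT, h, LocallyConstant.charFn, ← Order.succ_eq_add_one, not_le.mp h]

theorem Ptilde_eq_self_iff {σ : Ordinal.{0}} {f : C(Upto ω₁, 𝕜)} :
    Ptilde 𝕜 σ f = f ↔ ∀ x : Upto ω₁, σ < x → f x = f top := by
  rw [ContinuousMap.ext_iff]
  refine forall_congr' fun x => ?_
  rw [Ptilde_apply]
  split_ifs with h
  · simp [h.not_gt]
  · simp [not_le.mp h, eq_comm]

theorem Ptilde_apply_Ptilde {σ τ : Ordinal.{0}} (h : σ ≤ τ) (f : C(Upto ω₁, 𝕜)) :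
    Ptilde 𝕜 σ (Ptilde 𝕜 τ f) = Ptilde 𝕜 σ f := by
  ext x
  simp only [Ptilde_apply]
  split_ifs with h1 h2 h3
  · rfl
  · exact absurd (h1.trans h) h2
  · rfl
  · rfl

theorem Ptilde_eq_self_of_le {σ τ : Ordinal.{0}} (h : σ ≤ τ) {f : C(Upto ω₁, 𝕜)}
    (hf : Ptilde 𝕜 σ f = f) : Ptilde 𝕜 τ f = f :=
  Ptilde_eq_self_iff.mpr fun x hx => Ptilde_eq_self_iff.mp hf x (h.trans_lt hx)

theorem exists_Ptilde_eq_self (f : C(Upto ω₁, 𝕜)) :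
    ∃ σ : Ordinal.{0}, σ < ω₁ ∧ Ptilde 𝕜 σ f = f := by
  obtain ⟨σ, hσ, h⟩ := exists_eq_apply_top f
  exact ⟨σ, hσ, Ptilde_eq_self_iff.mpr fun x hx => h x hx.le⟩

theorem exists_forall_Ptilde_eq_self {D : Set C(Upto ω₁, 𝕜)} (hD : D.Countable) :
    ∃ σ : Ordinal.{0}, σ < ω₁ ∧ ∀ f ∈ D, Ptilde 𝕜 σ f = f := by
  choose s hs hs' using exists_Ptilde_eq_self (𝕜 := 𝕜)
  have := hD.to_subtype
  refine ⟨⨆ f : D, s f, Ordinal.iSup_lt_omega_one fun f => hs f, fun f hf => ?_⟩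
  exact Ptilde_eq_self_of_le (Ordinal.le_iSup (fun f : D => s f) ⟨f, hf⟩) (hs' f)

/-- `P̃_σ` factors through `C([0, σ + 1])`, the point `σ + 1` playing the role of `ω₁`. -/
theorem exists_Ptilde_eq_comp (σ : Ordinal.{0}) (hσ : σ < ω₁) :
    ∃ (S : C(Upto ω₁, 𝕜) →L[𝕜] C(Upto (σ + 1), 𝕜)) (R : C(Upto (σ + 1), 𝕜) →L[𝕜] C(Upto ω₁, 𝕜)),
      Ptilde 𝕜 σ = R ∘L S := by
  classical
  have hclopen : IsClopen {x : Upto (σ + 1) | (x : Ordinal) ≤ σ} := by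
    have h : IsClopen (Set.Iic σ) := by
      refine ⟨isClosed_Iic, ?_⟩
      rw [← Order.Iio_succ]
      exact isOpen_Iio
    exact h.preimage continuous_subtype_val
  -- `ι ∘ ρ` fixes `[0, σ]` and sends everything beyond to `ω₁`, so composing with it is `P̃_σ`. The
  -- `min` in `ι` changes nothing on `[0, σ]`; it only makes the first branch a globally defined
  -- continuous map.
  let ι : C(Upto (σ + 1), Upto ω₁) :=
    ⟨{x : Upto (σ + 1) | (x : Ordinal) ≤ σ}.piecewise
      (fun x => ⟨min x σ, (min_le_right _ _).trans hσ.le⟩) (fun _ => top),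
      Continuous.piecewise (by simp [hclopen.frontier_eq])
        ((continuous_subtype_val.min continuous_const).subtype_mk _) continuous_const⟩
  let ρ : C(Upto ω₁, Upto (σ + 1)) :=
    ⟨fun x => ⟨min x (σ + 1), Set.mem_Iic.mpr (min_le_right _ _)⟩,
      (continuous_subtype_val.min continuous_const).subtype_mk _⟩
  refine ⟨⟨(ContinuousMap.compRightAlgHom 𝕜 𝕜 ι).toLinearMap, ContinuousMap.continuous_precomp ι⟩,
    ⟨(ContinuousMap.compRightAlgHom 𝕜 𝕜 ρ).toLinearMap, ContinuousMap.continuous_precomp ρ⟩, ?_⟩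
  ext f x
  rw [Ptilde_apply]
  change _ = f (ι (ρ x))
  by_cases h : (x : Ordinal) ≤ σ
  · have h1 : min (x : Ordinal) (σ + 1) = x := min_eq_left (h.trans (Order.le_succ σ))
    simp [h, ι, ρ, Set.piecewise, h1]
  · have h1 : min (x : Ordinal) (σ + 1) = σ + 1 := min_eq_right (Order.succ_le_of_lt (not_le.mp h))
    have h2 : ¬ σ + 1 ≤ σ := (Order.lt_succ σ).not_ge
    simp [h, ι, ρ, Set.piecewise, h1, h2]

theorem succ_lt_omega_one {σ : Ordinal.{0}} (hσ : σ < ω₁) : σ + 1 < ω₁ :=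
  (Cardinal.isSuccLimit_omega 1).succ_lt hσ

/-! ### Separability of ranges. -/

theorem isSeparable_range_of_mem_closure_factorIdeal {X Y Z : Type*} [NormedAddCommGroup X]
    [NormedSpace 𝕜 X] [NormedAddCommGroup Y] [NormedSpace 𝕜 Y] [NormedAddCommGroup Z]
    [NormedSpace 𝕜 Z] [TopologicalSpace.SeparableSpace Z] {T : X →L[𝕜] Y}
    (hT : T ∈ closure (factorIdeal 𝕜 X Y Z : Set (X →L[𝕜] Y))) :
    TopologicalSpace.IsSeparable (Set.range T) := by
  have hfac : ∀ R ∈ factorIdeal 𝕜 X Y Z, TopologicalSpace.IsSeparable (Set.range R) := by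
    intro R hR
    induction hR using Submodule.span_induction with
    | mem R h =>
      obtain ⟨S, U, rfl⟩ := h
      exact (TopologicalSpace.isSeparable_range U.continuous).mono (by
        rintro _ ⟨x, rfl⟩
        exact ⟨S x, rfl⟩)
    | zero => exact (Set.countable_singleton (0 : Y)).isSeparable.mono (by rintro _ ⟨x, rfl⟩; simp)
    | add R R' _ _ h h' =>
      refine ((h.prod h').image continuous_add).mono ?_
      rintro _ ⟨x, rfl⟩
      exact ⟨(R x, R' x), ⟨⟨x, rfl⟩, ⟨x, rfl⟩⟩, rfl⟩
    | smul c R _ h =>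
      refine (h.image (continuous_const_smul c)).mono ?_
      rintro _ ⟨x, rfl⟩
      exact ⟨R x, ⟨x, rfl⟩, rfl⟩
  obtain ⟨u, hu, hlim⟩ := mem_closure_iff_seq_limit.mp hT
  have hU := TopologicalSpace.IsSeparable.iUnion fun n => hfac (u n) (hu n)
  refine hU.closure.mono ?_
  rintro _ ⟨x, rfl⟩
  refine mem_closure_of_tendsto ((ContinuousLinearMap.apply 𝕜 Y x).continuous.tendsto T |>.comp hlim)
    (.of_forall fun n => Set.mem_iUnion.mpr ⟨n, x, rfl⟩)

theorem exists_Ptilde_comp_eq_self_of_isSeparable {X : Type*} [NormedAddCommGroup X]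
    [NormedSpace 𝕜 X] {T : X →L[𝕜] C(Upto ω₁, 𝕜)}
    (hT : TopologicalSpace.IsSeparable (Set.range T)) :
    ∃ σ : Ordinal.{0}, σ < ω₁ ∧ ∀ f, Ptilde 𝕜 σ (T f) = T f := by
  obtain ⟨D, hD, hTD⟩ := hT
  obtain ⟨σ, hσ, h⟩ := exists_forall_Ptilde_eq_self hD
  refine ⟨σ, hσ, fun f => ?_⟩
  have hclosed : IsClosed {f | Ptilde 𝕜 σ f = f} :=
    isClosed_eq (Ptilde 𝕜 σ).continuous continuous_id
  exact closure_minimal (fun f hf => h f hf) hclosed (hTD ⟨f, rfl⟩)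

/-- The unit vectors are at mutual distance at least one, so balls of radius `1 / 2` around them are
disjoint. -/
theorem not_separableSpace_c0 {I : Type*} [Uncountable I] :
    ¬ TopologicalSpace.SeparableSpace (c0 𝕜 I) := by
  classical
  intro hsep
  let e (i : I) : c0 𝕜 I := ⟨lp.single ∞ i (1 : 𝕜), fun ε hε =>
    (Set.finite_singleton i).subset fun j hj => by
      by_contra hji
      have h0 : ‖lp.single (E := fun _ : I => 𝕜) ∞ i (1 : 𝕜) j‖ = 0 := by
        rw [lp.single_apply_ne _ _ _ hji, norm_zero]
      have : ε ≤ ‖lp.single (E := fun _ : I => 𝕜) ∞ i (1 : 𝕜) j‖ := hj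
      linarith⟩
  have hdist : ∀ i j, i ≠ j → 1 ≤ dist (e i) (e j) := by
    intro i j hij
    rw [dist_eq_norm]
    have h := lp.norm_apply_le_norm ENNReal.top_ne_zero
      ((e i - e j : c0 𝕜 I) : lp (fun _ : I => 𝕜) ∞) i
    have h' : (((e i - e j : c0 𝕜 I) : lp (fun _ : I => 𝕜) ∞) i : 𝕜) = 1 := by
      simp [e, lp.single_apply, hij]
    rw [h', norm_one] at h
    exact h
  have hdisj : Pairwise (Function.onFun Disjoint fun i => Metric.ball (e i) (1 / 2)) := by
    intro i j hij
    exact Metric.ball_disjoint_ball (by linarith [hdist i j hij])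
  have := hdisj.countable_of_isOpen_disjoint (fun i => Metric.isOpen_ball)
    fun i => ⟨e i, Metric.mem_ball_self (by norm_num)⟩
  exact not_countable this

theorem separableSpace_of_fixesCopy {X Y Z : Type*} [NormedAddCommGroup X]
    [NormedSpace 𝕜 X] [NormedAddCommGroup Y] [NormedSpace 𝕜 Y] [NormedAddCommGroup Z]
    [NormedSpace 𝕜 Z] {T : X →L[𝕜] Y} (hT : TopologicalSpace.IsSeparable (Set.range T))
    (h : FixesCopy Z T) : TopologicalSpace.SeparableSpace Z := by
  obtain ⟨W, ⟨e⟩, c, hc, hW⟩ := h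
  have hanti : AntilipschitzWith (Real.toNNReal c⁻¹) (T ∘L W.subtypeL) := by
    refine ContinuousLinearMap.antilipschitz_of_bound _ fun x => ?_
    rw [Real.coe_toNNReal _ (inv_pos.mpr hc).le, inv_mul_eq_div, le_div_iff₀ hc, mul_comm]
    exact hW x x.2
  have hind : Topology.IsInducing (T ∘L W.subtypeL) :=
    (hanti.isUniformInducing (T ∘L W.subtypeL).uniformContinuous).isInducing
  have hWsep : TopologicalSpace.SeparableSpace W := by
    rw [← TopologicalSpace.isSeparable_univ_iff]
    refine (hind.isSeparable_preimage hT).mono fun x _ => ?_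
    exact ⟨x, rfl⟩
  exact e.symm.surjective.denseRange.separableSpace e.symm.continuous

/-! ### From the kernels of `P̃_σ` to a copy of `c₀`. -/

/-- If `T` is nonzero on the kernel of every `P̃_σ`, there are uncountably many pairwise disjoint
functions in the unit ball that `T` does not annihilate. -/
theorem exists_uncountable_disjoint {Y : Type*} [NormedAddCommGroup Y] [NormedSpace 𝕜 Y]
    {T : C(Upto ω₁, 𝕜) →L[𝕜] Y}
    (hT : ∀ σ : Ordinal.{0}, σ < ω₁ → ∃ f, Ptilde 𝕜 σ f = 0 ∧ T f ≠ 0) :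
    ∃ A : Set C(Upto ω₁, 𝕜), ¬ A.Countable ∧ (∀ f ∈ A, ‖f‖ ≤ 1 ∧ T f ≠ 0) ∧
      A.Pairwise fun f g => f * g = 0 := by
  -- The condition `f top = 0` matters: a member fixed by `P̃_σ` then vanishes beyond `σ`, hence is
  -- disjoint from every function in the kernel of `P̃_σ`.
  let S : Set (Set C(Upto ω₁, 𝕜)) := {A | (∀ f ∈ A, ‖f‖ ≤ 1 ∧ f top = 0 ∧ T f ≠ 0) ∧
    A.Pairwise fun f g => f * g = 0}
  obtain ⟨A, hA⟩ := zorn_subset S fun c hc hchain => by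
    refine ⟨⋃₀ c, ⟨?_, ?_⟩, fun s hs => Set.subset_sUnion_of_mem hs⟩
    · rintro f ⟨s, hs, hf⟩
      exact (hc hs).1 f hf
    · exact (Set.pairwise_sUnion hchain.directedOn).mpr fun s hs => (hc hs).2
  refine ⟨A, fun hcount => ?_, fun f hf => ⟨(hA.prop.1 f hf).1, (hA.prop.1 f hf).2.2⟩, hA.prop.2⟩
  obtain ⟨σ, hσ, hfix⟩ := exists_forall_Ptilde_eq_self hcount
  obtain ⟨g, hg, hTg⟩ := hT σ hσ
  have hgx : ∀ x : Upto ω₁, (x : Ordinal) ≤ σ → g x = 0 := fun x hx => by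
    have := DFunLike.congr_fun hg x
    rwa [Ptilde_apply, if_pos hx] at this
  have hgtop : g top = 0 := by
    have := DFunLike.congr_fun hg top
    rwa [Ptilde_apply, ite_self] at this
  have hg0 : g ≠ 0 := fun h => hTg (by rw [h, map_zero])
  have hnorm : (‖g‖ : 𝕜) ≠ 0 := RCLike.ofReal_ne_zero.mpr (norm_ne_zero_iff.mpr hg0)
  let h : C(Upto ω₁, 𝕜) := (‖g‖ : 𝕜)⁻¹ • g
  have hTh : T h ≠ 0 := by
    rw [map_smul]
    exact smul_ne_zero (inv_ne_zero hnorm) hTg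
  have hdisj : ∀ f ∈ A, f * h = 0 := by
    intro f hf
    ext x
    by_cases hx : (x : Ordinal) ≤ σ
    · simp [h, hgx x hx]
    · have := Ptilde_eq_self_iff.mp (hfix f hf) x (not_le.mp hx)
      simp [this, (hA.prop.1 f hf).2.1]
  have hins : insert h A ∈ S := by
    refine ⟨?_, ?_⟩
    · rintro f (rfl | hf)
      · refine ⟨?_, ?_, hTh⟩
        · rw [norm_smul, norm_inv, RCLike.norm_ofReal, abs_norm,
            inv_mul_cancel₀ (norm_ne_zero_iff.mpr hg0)]
        · simp [h, hgtop]
      · exact hA.prop.1 f hf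
    · refine hA.prop.2.insert fun f hf _ => ⟨?_, hdisj f hf⟩
      rw [mul_comm]
      exact hdisj f hf
  -- Maximality puts `h` in `A`, yet `h` is disjoint from all of `A`, so `h * h = 0`.
  have hmem : h ∈ A := hA.le_of_ge hins (Set.subset_insert _ _) (Set.mem_insert _ _)
  have hsq := hdisj h hmem
  have hzero : h = 0 := by
    ext x
    exact mul_self_eq_zero.mp (DFunLike.congr_fun hsq x)
  exact hTh (by rw [hzero, map_zero])

theorem fixesCopy_c0_of_forall_exists_Ptilde_eq_zero {L : Type*} [TopologicalSpace L]
    [CompactSpace L] {T : C(Upto ω₁, 𝕜) →L[𝕜] C(L, 𝕜)}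
    (hT : ∀ σ : Ordinal.{0}, σ < ω₁ → ∃ f, Ptilde 𝕜 σ f = 0 ∧ T f ≠ 0) :
    FixesCopy (c0 𝕜 (Set.Iio (ω₁ : Ordinal.{0}))) T := by
  obtain ⟨A, hA, hA', hdisj⟩ := exists_uncountable_disjoint hT
  have hunion : A ⊆ ⋃ n : ℕ, {f ∈ A | 1 / ((n : ℝ) + 1) < ‖T f‖} := by
    intro f hf
    obtain ⟨n, hn⟩ := exists_nat_one_div_lt (norm_pos_iff.mpr (hA' f hf).2)
    exact Set.mem_iUnion.mpr ⟨n, hf, hn⟩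
  obtain ⟨n, hn⟩ : ∃ n : ℕ, ¬ {f ∈ A | 1 / ((n : ℝ) + 1) < ‖T f‖}.Countable := by
    by_contra! h
    exact hA ((Set.countable_iUnion h).mono hunion)
  have : Uncountable {f ∈ A | 1 / ((n : ℝ) + 1) < ‖T f‖} :=
    not_countable_iff.mp fun h => hn (Set.countable_coe_iff.mp h)
  obtain ⟨e⟩ := nonempty_embedding_Iio_omega_one
    (α := {f ∈ A | 1 / ((n : ℝ) + 1) < ‖T f‖})
  have := uncountable_Iio_omega_one
  refine fixesCopy_c0_of_disjoint (g := fun i => (e i : C(Upto ω₁, 𝕜)))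
    (fun i => (hA' _ (e i).2.1).1) (fun i j hij => ?_) T (δ := 1 / ((n : ℝ) + 1))
    Nat.one_div_pos_of_nat fun i => (e i).2.2
  exact hdisj (e i).2.1 (e j).2.1 fun h => hij (e.injective (Subtype.ext h))

/-- `P̃_τ f - f` lies in the kernel of `P̃_σ` when `σ ≤ τ`. All larger `τ` are included so that the
index can later be enlarged. -/
theorem exists_comp_Ptilde_eq_self_of_not_fixesCopy {L : Type*} [TopologicalSpace L]
    [CompactSpace L] {T : C(Upto ω₁, 𝕜) →L[𝕜] C(L, 𝕜)}
    (hT : ¬ FixesCopy (c0 𝕜 (Set.Iio (ω₁ : Ordinal.{0}))) T) :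
    ∃ σ : Ordinal.{0}, σ < ω₁ ∧ ∀ τ, σ ≤ τ → T ∘L Ptilde 𝕜 τ = T := by
  have h := mt fixesCopy_c0_of_forall_exists_Ptilde_eq_zero hT
  push Not at h
  obtain ⟨σ, hσ, h⟩ := h
  refine ⟨σ, hσ, fun τ hτ => ?_⟩
  ext1 f
  have := h (Ptilde 𝕜 τ f - f) (by rw [map_sub, Ptilde_apply_Ptilde hτ, sub_self])
  rwa [map_sub, sub_eq_zero] at this

theorem isSeparable_range_of_comp_Ptilde_eq_self {Y : Type*} [NormedAddCommGroup Y]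
    [NormedSpace 𝕜 Y] {T : C(Upto ω₁, 𝕜) →L[𝕜] Y} {σ : Ordinal.{0}} (hσ : σ < ω₁)
    (hT : T ∘L Ptilde 𝕜 σ = T) : TopologicalSpace.IsSeparable (Set.range T) := by
  obtain ⟨S, R, hSR⟩ := exists_Ptilde_eq_comp (𝕜 := 𝕜) σ hσ
  have := separableSpace_continuousMap_upto (𝕜 := 𝕜) (succ_lt_omega_one hσ)
  refine isSeparable_range_of_mem_closure_factorIdeal (𝕜 := 𝕜) (Z := C(Upto (σ + 1), 𝕜))
    (subset_closure (Submodule.subset_span ⟨S, T ∘L R, ?_⟩))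
  rw [ContinuousLinearMap.comp_assoc, ← hSR, hT]

end OrdinalInterval

theorem theorem1p3 (𝕜 : Type*) [RCLike 𝕜]
    (T : C(OrdinalInterval.Upto ω₁, 𝕜) →L[𝕜] C(OrdinalInterval.Upto ω₁, 𝕜)) :
    List.TFAE [
      ∃ σ : Ordinal.{0}, σ < ω₁ ∧
        T = OrdinalInterval.Ptilde 𝕜 σ ∘L T ∘L OrdinalInterval.Ptilde 𝕜 σ,
      ∃ σ : Ordinal.{0}, σ < ω₁ ∧
        T ∈ OrdinalInterval.factorIdeal 𝕜 C(OrdinalInterval.Upto ω₁, 𝕜)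
          C(OrdinalInterval.Upto ω₁, 𝕜) C(OrdinalInterval.Upto σ, 𝕜),
      ∃ σ : Ordinal.{0}, σ < ω₁ ∧
        T ∈ closure (OrdinalInterval.factorIdeal 𝕜 C(OrdinalInterval.Upto ω₁, 𝕜)
          C(OrdinalInterval.Upto ω₁, 𝕜) C(OrdinalInterval.Upto σ, 𝕜) :
            Set (C(OrdinalInterval.Upto ω₁, 𝕜) →L[𝕜] C(OrdinalInterval.Upto ω₁, 𝕜))),
      TopologicalSpace.IsSeparable (Set.range T),
      ¬ OrdinalInterval.FixesCopy
          (OrdinalInterval.c0 𝕜 (Set.Iio (ω₁ : Ordinal.{0}))) T] := by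
  tfae_have 1 → 2 := by
    rintro ⟨σ, hσ, hT⟩
    obtain ⟨S, R, hSR⟩ := OrdinalInterval.exists_Ptilde_eq_comp (𝕜 := 𝕜) σ hσ
    refine ⟨σ + 1, OrdinalInterval.succ_lt_omega_one hσ, Submodule.subset_span
      ⟨S, OrdinalInterval.Ptilde 𝕜 σ ∘L T ∘L R, ?_⟩⟩
    rw [ContinuousLinearMap.comp_assoc, ContinuousLinearMap.comp_assoc, ← hSR]
    exact hT
  tfae_have 2 → 3 := fun ⟨σ, hσ, hT⟩ => ⟨σ, hσ, subset_closure hT⟩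
  tfae_have 3 → 4 := by
    rintro ⟨σ, hσ, hT⟩
    have := OrdinalInterval.separableSpace_continuousMap_upto (𝕜 := 𝕜) hσ
    exact OrdinalInterval.isSeparable_range_of_mem_closure_factorIdeal hT
  tfae_have 4 → 5 := by
    intro hT hfix
    have := OrdinalInterval.uncountable_Iio_omega_one
    exact OrdinalInterval.not_separableSpace_c0 (𝕜 := 𝕜)
      (OrdinalInterval.separableSpace_of_fixesCopy hT hfix)
  tfae_have 5 → 1 := by
    intro hT
    obtain ⟨σ, hσ, hright⟩ :=
      OrdinalInterval.exists_comp_Ptilde_eq_self_of_not_fixesCopy hT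
    obtain ⟨τ, hτ, hleft⟩ := OrdinalInterval.exists_Ptilde_comp_eq_self_of_isSeparable
      (OrdinalInterval.isSeparable_range_of_comp_Ptilde_eq_self hσ (hright σ le_rfl))
    refine ⟨max σ τ, max_lt hσ hτ, ?_⟩
    rw [hright _ (le_max_left _ _)]
    ext1 f
    exact (OrdinalInterval.Ptilde_eq_self_of_le (le_max_right _ _) (hleft f)).symm
  tfae_finish
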